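/- Let $N\ge 1$, let $I_1,\dots,I_N$, $r_1,\dots,r_N$ and $m$ be nonnegative integers, and let $\mathfrak F:\mathbb R^{I_1\times\cdots\times I_N}\to\mathbb R^m$ be a linear operator. For a tensor $\mathcal X\in\mathbb R^{I_1\times\cdots\times I_N}$ let $X_{(n)}$ be its mode-$n$ unfolding (the matrix whose columns are the mode-$n$ fibers of $\mathcal X$), let $\|\mathcal X\|_F$ be its Frobenius norm, and let $\|\mathcal X\|_*:=\frac1N\sum_{n=1}^N\|X_{(n)}\|_*$, where $\|X_{(n)}\|_*$ is the sum of the singular values of $X_{(n)}$. Say that $\mathcal X$ has rank at most $(s_1,\dots,s_N)$ if $\operatorname{rank}X_{(n)}\le s_n$ for $n=1,\dots,N$, and let $\delta_{(s_1,\dots,s_N)}$ be the smallest $\delta\ge0$ such that $$(1-\delta)\|\mathcal X\|_F^2\le\|\mathfrak F(\mathcal X)\|_2^2\le(1+\delta)\|\mathcal X\|_F^2$$ for all tensors $\mathcal X$ of rank at most $(s_1,\dots,s_N)$. Suppose that $$\delta_{(I_1,\dots,I_{n-1},\,2r_n,\,I_{n+1},\dots,I_N)}<\frac{77-\sqrt{1337}}{82}\approx0.4931\qquad\text{for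 every } n=1,\dots,N.$$ Then for every tensor $\mathcal X^0$ of rank at most $(r_1,\dots,r_N)$, with $b=\mathfrak F(\mathcal X^0)$, the tensor $\mathcal X^0$ is the unique solution of the problem $$\min_{\mathcal X}\{\|\mathcal X\|_*:\mathfrak F(\mathcal X)=b\}.$$ -/

import Mathlib

/-- Real `N`-way tensors of size `I 0 × ⋯ × I (N - 1)`, as arrays of entries indexed by
multi-indices. The inner product is the sum of the products of the entries, so the norm `‖X‖` is
the Frobenius norm. -/
abbrev Tensor {N : ℕ} (I : Fin N → ℕ) : Type :=
  EuclideanSpace ℝ ((n : Fin N) → Fin (I n))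

namespace Tensor

/-- The mode-`n` unfolding. Its rows are indexed by the `n`-th index and its columns by the
remaining indices, so that its columns are the mode-`n` fibers. -/
def unfold {N : ℕ} {I : Fin N → ℕ} (n : Fin N) (X : Tensor I) :
    Matrix (Fin (I n)) ((k : {k : Fin N // k ≠ n}) → Fin (I k)) ℝ :=
  Matrix.of fun i j => X ((Equiv.piSplitAt n fun k => Fin (I k)).symm (i, j))

/-- The trace norm of a real matrix: the sum of its singular values. -/
noncomputable def matrixTraceNorm {p q : Type*} [Fintype p] [Fintype q] [DecidableEq q]
    (A : Matrix p q ℝ) : ℝ :=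
  (Matrix.toEuclideanLin A).singularValues.sum fun _ s => s

/-- The trace norm of a tensor: the mean of the trace norms of its unfoldings. -/
noncomputable def traceNorm {N : ℕ} {I : Fin N → ℕ} (X : Tensor I) : ℝ :=
  (1 / (N : ℝ)) * ∑ n : Fin N, matrixTraceNorm (unfold n X)

/-- The tensors of rank at most `(r 0, …, r (N - 1))`: the `n`-rank, which is the rank of the
mode-`n` unfolding, is at most `r n` for every mode `n`. -/
def lowRank {N : ℕ} (I : Fin N → ℕ) (r : Fin N → ℕ) : Set (Tensor I) :=
  {X | ∀ n, (unfold n X).rank ≤ r n}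

/-- The numbers `δ ≥ 0` with which `F` satisfies the restricted isometry inequalities on the
tensors of rank at most `r`. As soon as one of these tensors is nonzero, the two inequalities
alone force `0 ≤ δ`. -/
def ripSet {N m : ℕ} {I : Fin N → ℕ} (F : Tensor I →ₗ[ℝ] EuclideanSpace ℝ (Fin m))
    (r : Fin N → ℕ) : Set ℝ :=
  {δ | 0 ≤ δ ∧ ∀ X ∈ lowRank I r,
    (1 - δ) * ‖X‖ ^ 2 ≤ ‖F X‖ ^ 2 ∧ ‖F X‖ ^ 2 ≤ (1 + δ) * ‖X‖ ^ 2}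

/-- The tensor restricted isometry constant `δ_r` of `F`: the smallest element of `ripSet F r`. -/
noncomputable def ripConst {N m : ℕ} {I : Fin N → ℕ}
    (F : Tensor I →ₗ[ℝ] EuclideanSpace ℝ (Fin m)) (r : Fin N → ℕ) : ℝ :=
  sInf (ripSet F r)

/-- The infimum in the definition of the restricted isometry constant is always attained. -/
theorem isLeast_ripConst {N m : ℕ} {I : Fin N → ℕ}
    (F : Tensor I →ₗ[ℝ] EuclideanSpace ℝ (Fin m)) (r : Fin N → ℕ) :
    IsLeast (ripSet F r) (ripConst F r) := by
  have hbdd : BddBelow (ripSet F r) := ⟨0, fun δ h => h.1⟩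
  have hclosed : IsClosed (ripSet F r) := by
    have h : ripSet F r = Set.Ici 0 ∩ ⋂ X ∈ lowRank I r,
        ({δ | (1 - δ) * ‖X‖ ^ 2 ≤ ‖F X‖ ^ 2} ∩ {δ | ‖F X‖ ^ 2 ≤ (1 + δ) * ‖X‖ ^ 2}) := by
      ext δ
      simp [ripSet]
    rw [h]
    refine isClosed_Ici.inter (isClosed_biInter fun X _ => IsClosed.inter ?_ ?_)
    · exact isClosed_le (by fun_prop) (by fun_prop)
    · exact isClosed_le (by fun_prop) (by fun_prop)
  have hne : (ripSet F r).Nonempty := by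
    set G := LinearMap.toContinuousLinearMap F with hG
    refine ⟨1 + ‖G‖ ^ 2, by positivity, fun X _ => ⟨?_, ?_⟩⟩
    · nlinarith [sq_nonneg (‖F X‖), mul_nonneg (sq_nonneg ‖G‖) (sq_nonneg ‖X‖)]
    · have h1 : ‖F X‖ ≤ ‖G‖ * ‖X‖ := G.le_opNorm X
      have h2 : ‖F X‖ ^ 2 ≤ (‖G‖ * ‖X‖) ^ 2 := pow_le_pow_left₀ (norm_nonneg _) h1 2
      nlinarith [sq_nonneg ‖X‖]
  exact ⟨hclosed.csInf_mem hne hbdd, fun δ h => csInf_le hbdd h⟩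

/-- The set of solutions of the problem `min {‖X‖_* : F X = b}`, where `‖X‖_*` is the tensor
trace norm. -/
def traceNormSolutions {N m : ℕ} {I : Fin N → ℕ}
    (F : Tensor I →ₗ[ℝ] EuclideanSpace ℝ (Fin m)) (b : EuclideanSpace ℝ (Fin m)) :
    Set (Tensor I) :=
  {X | F X = b ∧ ∀ Y : Tensor I, F Y = b → traceNorm X ≤ traceNorm Y}

end Tensor

/-! The modes decouple. The `n`-th hypothesis restricts the rank in mode `n` only, so it is a matrix
isometry condition, and it forces every `Y ≠ X₀` with `F Y = F X₀` to have a mode-`n` unfolding of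
strictly larger trace norm than that of `X₀`. Averaging over the modes gives the theorem.

Let `A` and `D` be the mode-`n` unfoldings of `X₀` and of `Z = Y - X₀`, and let `k = rank A`. A
Lidskii-type inequality for the symmetric dilations (`LinearMap.sum_singularValues_add_le`) bounds
the trace norm of `A + D` below by that of `A`, minus the `k` leading singular values of `D`, plus
the others. If the trace norm does not increase, the leading `k` dominate the tail in sum.

The singular pairs of `D` form orthonormal tensors of mode-`n` rank one, so what remains is sparse
recovery (`sum_smul_eq_zero_of_restricted_isometry`). Let `t` be the leading part of `Z`. The tail
coefficients lie in a polytope with `k`-sparse vertices, and minimising `⟪F t, F ·⟫` there replaces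
the tail by a `k`-sparse `w` with `‖w‖ ≤ ‖t‖` and `⟪F t, F (t + w)⟫ ≤ ⟪F t, F Z⟫ = 0`. The isometry
property on combinations of `t` and `w` forces `t = 0`, hence `Z = 0`. It is enough that `δ ≤ 1 /
2`. -/

open Module InnerProductSpace

/-! ### Eigenvalue inequalities for symmetric operators. -/

section SpectralPerturbation

variable {H : Type*} [NormedAddCommGroup H] [InnerProductSpace ℝ H] [FiniteDimensional ℝ H]

/-- Weyl's min-max bound: a symmetric operator bounded below by `μ` on a subspace of dimension
greater than `j` has at least `j + 1` eigenvalues that are at least `μ`. -/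
theorem LinearMap.IsSymmetric.le_eigenvalues_of_lt_finrank {S : H →ₗ[ℝ] H} (hS : S.IsSymmetric)
    {d : ℕ} (hd : finrank ℝ H = d) (j : Fin d) {V : Submodule ℝ H} (hV : (j : ℕ) < finrank ℝ V)
    {μ : ℝ} (h : ∀ x ∈ V, μ * ‖x‖ ^ 2 ≤ ⟪S x, x⟫_ℝ) : μ ≤ hS.eigenvalues hd j := by
  set e := hS.eigenvectorBasis hd with he
  -- By dimension, `V` contains a nonzero vector orthogonal to the first `j` eigenvectors.
  set f : V →ₗ[ℝ] (Fin j → ℝ) :=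
    LinearMap.pi fun i => (innerₛₗ ℝ (e (Fin.castLE j.2.le i))) ∘ₗ V.subtype with hf
  have hker : f.ker ≠ ⊥ := LinearMap.ker_ne_bot_of_finrank_lt (by simpa using hV)
  obtain ⟨x, hx, hx0⟩ := Submodule.exists_mem_ne_zero_of_ne_bot hker
  have hx1 : ∀ i : Fin d, i < j → ⟪e i, (x : H)⟫_ℝ = 0 := by
    intro i hi
    have := congrFun (LinearMap.mem_ker.1 hx) ⟨i, hi⟩
    simpa [hf] using this
  have hSx : ⟪S x, (x : H)⟫_ℝ = ∑ i, hS.eigenvalues hd i * ⟪e i, (x : H)⟫_ℝ ^ 2 := by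
    rw [← e.sum_inner_mul_inner]
    refine Finset.sum_congr rfl fun i _ => ?_
    rw [hS, he, hS.apply_eigenvectorBasis hd, inner_smul_right, real_inner_comm]
    simp [pow_two, mul_assoc]
  have hnx : ‖(x : H)‖ ^ 2 = ∑ i, ⟪e i, (x : H)⟫_ℝ ^ 2 := by
    rw [← e.sum_sq_norm_inner_right]; simp
  have hle : ⟪S x, (x : H)⟫_ℝ ≤ hS.eigenvalues hd j * ‖(x : H)‖ ^ 2 := by
    rw [hSx, hnx, Finset.mul_sum]
    refine Finset.sum_le_sum fun i _ => ?_
    rcases lt_or_ge i j with hij | hij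
    · simp [hx1 i hij]
    · exact mul_le_mul_of_nonneg_right (hS.eigenvalues_antitone hd hij) (sq_nonneg _)
  have hpos : 0 < ‖(x : H)‖ ^ 2 := by
    have : (x : H) ≠ 0 := by simpa using hx0
    positivity
  exact le_of_mul_le_mul_right ((h x x.2).trans hle) hpos

variable {k : ℕ} {p n : Fin k → H} {s : ℕ → ℝ}

/-- On the span of `p 0, …, p j`, of dimension `j + 1`, the `n`-terms vanish and the form is at
least `s j * ‖x‖ ^ 2`. -/
theorem LinearMap.IsSymmetric.le_eigenvalues_of_sum_le {S : H →ₗ[ℝ] H} (hS : S.IsSymmetric)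
    {d : ℕ} (hd : finrank ℝ H = d) (hp : Orthonormal ℝ p)
    (hpn : ∀ i j, ⟪p i, n j⟫_ℝ = 0) (hs : Antitone s)
    (h : ∀ x, ∑ i : Fin k, s i * (⟪p i, x⟫_ℝ ^ 2 - ⟪n i, x⟫_ℝ ^ 2) ≤ ⟪S x, x⟫_ℝ)
    (j : Fin d) (hj : (j : ℕ) < k) : s j ≤ hS.eigenvalues hd j := by
  have hjk : (j : ℕ) + 1 ≤ k := hj
  have hp' : Orthonormal ℝ (p ∘ Fin.castLE hjk) := hp.comp _ (Fin.castLE_injective hjk)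
  refine hS.le_eigenvalues_of_lt_finrank hd j
    (V := Submodule.span ℝ (Set.range (p ∘ Fin.castLE hjk))) ?_ fun x hx => le_trans ?_ (h x)
  · rw [finrank_span_eq_card hp'.linearIndependent]; simp
  obtain ⟨c, rfl⟩ := (Submodule.mem_span_range_iff_exists_fun ℝ).1 hx
  set x := ∑ i, c i • (p ∘ Fin.castLE hjk) i with hxdef
  have hn0 : ∀ i, ⟪n i, x⟫_ℝ = 0 := fun i => by
    rw [hxdef, inner_sum]
    exact Finset.sum_eq_zero fun l _ => by
      rw [inner_smul_right, Function.comp_apply, real_inner_comm, hpn, mul_zero]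
  have hp0 : ∀ i : Fin k, (j : ℕ) < i → ⟪p i, x⟫_ℝ = 0 := fun i hi => by
    rw [hxdef, inner_sum]
    refine Finset.sum_eq_zero fun l _ => ?_
    rw [inner_smul_right, Function.comp_apply, hp.2 (i := i), mul_zero]
    intro h
    have := congrArg Fin.val h
    simp only [Fin.val_castLE] at this
    omega
  have hx1 : ‖x‖ ^ 2 ≤ ∑ i, ⟪p i, x⟫_ℝ ^ 2 := by
    have h1 : ‖x‖ ^ 2 = ∑ l, ⟪p (Fin.castLE hjk l), x⟫_ℝ ^ 2 := by
      rw [← real_inner_self_eq_norm_sq]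
      conv_lhs => rw [hxdef]
      rw [sum_inner]
      refine Finset.sum_congr rfl fun l _ => ?_
      have : ⟪p (Fin.castLE hjk l), x⟫_ℝ = c l := hp'.inner_right_fintype c l
      rw [inner_smul_left, Function.comp_apply, this]
      simp [pow_two]
    rw [h1, ← Finset.sum_image (s := Finset.univ) (g := Fin.castLE hjk)
      (f := fun i => ⟪p i, x⟫_ℝ ^ 2) (fun _ _ _ _ h => Fin.castLE_injective hjk h)]
    exact Finset.sum_le_sum_of_subset_of_nonneg (Finset.subset_univ _) fun _ _ _ => sq_nonneg _
  have hx2 : ∑ i, ⟪p i, x⟫_ℝ ^ 2 ≤ ‖x‖ ^ 2 := by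
    simpa using hp.sum_inner_products_le x (s := Finset.univ)
  rw [le_antisymm hx1 hx2, Finset.mul_sum]
  refine Finset.sum_le_sum fun i _ => ?_
  rw [hn0]
  rcases lt_or_ge (j : ℕ) i with hij | hij
  · simp [hp0 i hij]
  · have := hs hij
    nlinarith [sq_nonneg ⟪p i, x⟫_ℝ]

/-- Orthogonally to `n 0, …, n (m - 1)`, a space of dimension at least `d - m > j`, Bessel's
inequality bounds the form below by `-s m * ‖x‖ ^ 2`. -/
theorem LinearMap.IsSymmetric.neg_le_eigenvalues_of_sum_le {S : H →ₗ[ℝ] H} (hS : S.IsSymmetric)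
    {d : ℕ} (hd : finrank ℝ H = d) (hn : Orthonormal ℝ n) (hs : Antitone s) (hs0 : ∀ i, 0 ≤ s i)
    (h : ∀ x, ∑ i : Fin k, s i * (⟪p i, x⟫_ℝ ^ 2 - ⟪n i, x⟫_ℝ ^ 2) ≤ ⟪S x, x⟫_ℝ)
    (j : Fin d) (m : ℕ) (hj : (j : ℕ) + m < d) : -s m ≤ hS.eigenvalues hd j := by
  classical
  set A := (Finset.univ.filter fun i : Fin k => (i : ℕ) < m).image n with hA
  have hcard : A.card ≤ m := by
    refine Finset.card_image_le.trans ?_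
    calc (Finset.univ.filter fun i : Fin k => (i : ℕ) < m).card
        ≤ (Finset.range m).card := Finset.card_le_card_of_injOn Fin.val
          (fun i hi => by simpa using hi) (fun _ _ _ _ h => Fin.ext h)
      _ = m := Finset.card_range m
  refine hS.le_eigenvalues_of_lt_finrank hd j (V := (Submodule.span ℝ (A : Set H))ᗮ) ?_
    fun x hx => le_trans ?_ (h x)
  · have h1 := Submodule.finrank_add_finrank_orthogonal (Submodule.span ℝ (A : Set H))
    have h2 := finrank_span_finset_le_card (R := ℝ) A
    rw [Set.finrank] at h2
    omega
  have hx0 : ∀ i : Fin k, (i : ℕ) < m → ⟪n i, x⟫_ℝ = 0 := fun i hi =>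
    hx _ (Submodule.subset_span (by
      rw [hA, Finset.mem_coe]
      exact Finset.mem_image_of_mem _ (by simpa using hi)))
  have hb : ∑ i, ⟪n i, x⟫_ℝ ^ 2 ≤ ‖x‖ ^ 2 := by
    simpa using hn.sum_inner_products_le x (s := Finset.univ)
  have hb' := mul_le_mul_of_nonneg_left hb (hs0 m)
  rw [Finset.mul_sum] at hb'
  calc -s m * ‖x‖ ^ 2 ≤ ∑ i : Fin k, -(s m * ⟪n i, x⟫_ℝ ^ 2) := by
        rw [Finset.sum_neg_distrib]; linarith
    _ ≤ _ := by
        refine Finset.sum_le_sum fun i _ => ?_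
        have h1 := mul_nonneg (hs0 i) (sq_nonneg ⟪p i, x⟫_ℝ)
        rcases lt_or_ge (i : ℕ) m with him | him
        · rw [hx0 i him]; nlinarith
        · have := mul_le_mul_of_nonneg_right (hs him) (sq_nonneg ⟪n i, x⟫_ℝ)
          nlinarith

/-- A perturbation inequality of Lidskii type: `∑ᵢ aᵢ (pᵢ pᵢᵀ - nᵢ nᵢᵀ)` is, for each of the three
families, a symmetric operator with spectrum symmetric about zero. -/
theorem sum_add_sum_le_of_quadratic_eq_add {ka kb kc : ℕ} {a b c : ℕ → ℝ}
    {pa na : Fin ka → H} {pb nb : Fin kb → H} {pc nc : Fin kc → H}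
    (ha : Antitone a) (ha0 : ∀ i, 0 ≤ a i) (hak : a ka = 0)
    (hb : Antitone b) (hb0 : ∀ i, 0 ≤ b i) (hbk : ∀ i, kb ≤ i → b i = 0)
    (hc0 : ∀ i, 0 ≤ c i)
    (hpa : Orthonormal ℝ pa) (hna : Orthonormal ℝ na) (hpna : ∀ i j, ⟪pa i, na j⟫_ℝ = 0)
    (hpb : Orthonormal ℝ pb) (hnb : Orthonormal ℝ nb) (hpnb : ∀ i j, ⟪pb i, nb j⟫_ℝ = 0)
    (hpc : Orthonormal ℝ pc)
    (hq : ∀ x, ∑ i : Fin kc, c i * (⟪pc i, x⟫_ℝ ^ 2 - ⟪nc i, x⟫_ℝ ^ 2) =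
      ∑ i : Fin ka, a i * (⟪pa i, x⟫_ℝ ^ 2 - ⟪na i, x⟫_ℝ ^ 2) +
      ∑ i : Fin kb, b i * (⟪pb i, x⟫_ℝ ^ 2 - ⟪nb i, x⟫_ℝ ^ 2))
    (haa : ka + ka ≤ finrank ℝ H) (hab : kb + ka ≤ finrank ℝ H) :
    ∑ i ∈ Finset.range ka, a i + ∑ i ∈ Finset.Ico ka (max ka kb), b i ≤
      ∑ i ∈ Finset.range kc, c i + ∑ i ∈ Finset.range ka, b i := by
  obtain ⟨m, hm⟩ := Nat.exists_eq_add_of_le haa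
  have hd : finrank ℝ H = ka + m + ka := by omega
  -- Write `C = A + B` for the operators of the three families. Then `S = C₊ - B`, with `C₊` the
  -- `pc`-part of `C`, satisfies `S ≥ A` and `S ≥ -B`, and its trace is `∑ c` because `B` has trace
  -- zero.
  set S : H →ₗ[ℝ] H := ∑ i : Fin kc, c i • (rankOne ℝ (pc i) (pc i)).toLinearMap
    - ∑ i : Fin kb, b i • (rankOne ℝ (pb i) (pb i)).toLinearMap
    + ∑ i : Fin kb, b i • (rankOne ℝ (nb i) (nb i)).toLinearMap with hSdef
  have hsum : ∀ {k : ℕ} (s : ℕ → ℝ) (v : Fin k → H),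
      (∑ i : Fin k, s i • (rankOne ℝ (v i) (v i)).toLinearMap).IsSymmetric := fun s v =>
    LinearMap.isSymmetric_sum _ fun i _ =>
      (isSymmetric_rankOne_self (v i)).smul (by simp)
  have hS : S.IsSymmetric := ((hsum c pc).sub (hsum b pb)).add (hsum b nb)
  have hqS : ∀ x, ⟪S x, x⟫_ℝ = ∑ i : Fin kc, c i * ⟪pc i, x⟫_ℝ ^ 2 -
      ∑ i : Fin kb, b i * (⟪pb i, x⟫_ℝ ^ 2 - ⟪nb i, x⟫_ℝ ^ 2) := by
    intro x
    simp only [hSdef, LinearMap.add_apply, LinearMap.sub_apply, LinearMap.sum_apply,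
      LinearMap.smul_apply, inner_add_left, inner_sub_left, sum_inner, inner_smul_left,
      ContinuousLinearMap.coe_coe, rankOne_apply, mul_sub, Finset.sum_sub_distrib]
    simp only [pow_two, conj_trivial]
    ring
  have htr : ∑ j, hS.eigenvalues hd j = ∑ i ∈ Finset.range kc, c i := by
    have h1 := hS.trace_eq_sum_eigenvalues hd
    have h2 : LinearMap.trace ℝ H S = ∑ i : Fin kc, c i := by
      simp only [hSdef, map_add, map_sub, map_sum, map_smul, trace_rankOne, smul_eq_mul,
        real_inner_self_eq_norm_sq, hpc.1, hpb.1, hnb.1]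
      simp
    rw [← Fin.sum_univ_eq_sum_range, ← h2, h1]; simp
  have hA : ∀ x, ∑ i : Fin ka, a i * (⟪pa i, x⟫_ℝ ^ 2 - ⟪na i, x⟫_ℝ ^ 2) ≤ ⟪S x, x⟫_ℝ := by
    intro x
    have h1 := hq x
    have h2 : 0 ≤ ∑ i : Fin kc, c i * ⟪nc i, x⟫_ℝ ^ 2 :=
      Finset.sum_nonneg fun i _ => mul_nonneg (hc0 i) (sq_nonneg _)
    rw [hqS]
    simp only [mul_sub, Finset.sum_sub_distrib] at h1 ⊢
    linarith
  have hB : ∀ x, ∑ i : Fin kb, b i * (⟪nb i, x⟫_ℝ ^ 2 - ⟪pb i, x⟫_ℝ ^ 2) ≤ ⟪S x, x⟫_ℝ := by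
    intro x
    have h2 : 0 ≤ ∑ i : Fin kc, c i * ⟪pc i, x⟫_ℝ ^ 2 :=
      Finset.sum_nonneg fun i _ => mul_nonneg (hc0 i) (sq_nonneg _)
    rw [hqS]
    simp only [mul_sub, Finset.sum_sub_distrib]
    linarith
  have hpnb' : ∀ i j, ⟪nb i, pb j⟫_ℝ = 0 := fun i j => by rw [real_inner_comm, hpnb]
  -- Lower bounds for the eigenvalues of `S`: the top `ka` from `S ≥ A`, the bottom `ka` from `S ≥
  -- -B`.
  set g : ℕ → ℝ := fun j => if j < ka then a j else if j < ka + m then b j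
    else -b (ka + m + ka - 1 - j) with hg
  have hle : ∑ j : Fin (ka + m + ka), g j ≤ ∑ j, hS.eigenvalues hd j := by
    refine Finset.sum_le_sum fun j _ => ?_
    simp only [hg]
    split_ifs with h1 h2
    · exact hS.le_eigenvalues_of_sum_le hd hpa hpna ha hA j h1
    · rcases lt_or_ge (j : ℕ) kb with h3 | h3
      · exact hS.le_eigenvalues_of_sum_le hd hnb hpnb' hb hB j h3
      -- Beyond `kb` the bound is zero and comes from `S ≥ A`, since `A` has at most `ka` negative
      -- directions.
      · rw [hbk j h3]
        have := hS.neg_le_eigenvalues_of_sum_le hd hna ha ha0 hA j ka (by omega)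
        rwa [hak, neg_zero] at this
    · exact hS.neg_le_eigenvalues_of_sum_le hd hpb hb hb0 hB j _ (by omega)
  rw [htr, Fin.sum_univ_eq_sum_range, Finset.sum_range_add, Finset.sum_range_add] at hle
  have h1 : ∑ j ∈ Finset.range ka, g j = ∑ j ∈ Finset.range ka, a j :=
    Finset.sum_congr rfl fun j hj => by simp [hg, Finset.mem_range.1 hj]
  have h2 : ∑ j ∈ Finset.range m, g (ka + j) = ∑ i ∈ Finset.Ico ka (max ka kb), b i := by
    have : ∑ j ∈ Finset.range m, g (ka + j) = ∑ j ∈ Finset.range m, b (ka + j) :=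
      Finset.sum_congr rfl fun j hj => by simp [hg, Finset.mem_range.1 hj]
    rw [this, Finset.sum_Ico_eq_sum_range]
    refine (Finset.sum_subset (Finset.range_subset_range.2 (by omega)) fun j _ hj => ?_).symm
    simp only [Finset.mem_range, not_lt] at hj
    exact hbk _ (by omega)
  have h3 : ∑ j ∈ Finset.range ka, g (ka + m + j) = -∑ j ∈ Finset.range ka, b j := by
    rw [← Finset.sum_range_reflect, ← Finset.sum_neg_distrib]
    refine Finset.sum_congr rfl fun j hj => ?_
    have := Finset.mem_range.1 hj
    simp only [hg]
    rw [if_neg (by omega), if_neg (by omega)]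
    congr 2
    omega
  linarith

end SpectralPerturbation

/-! ### Singular values through the symmetric dilation. -/

section SingularValueDecomposition

variable {E F : Type*} [NormedAddCommGroup E] [InnerProductSpace ℝ E] [FiniteDimensional ℝ E]
  [NormedAddCommGroup F] [InnerProductSpace ℝ F] [FiniteDimensional ℝ F]

theorem LinearMap.sum_singularValues_eq (T : E →ₗ[ℝ] F) {N : ℕ} (hN : finrank ℝ T.range ≤ N) :
    (T.singularValues.sum fun _ s => s) = ∑ i ∈ Finset.range N, T.singularValues i :=
  Finsupp.sum_of_support_subset _
    (by rw [T.support_singularValues]; exact Finset.range_subset_range.2 hN) _ (fun _ _ => rfl)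

/-- The compact singular value decomposition. -/
theorem LinearMap.exists_singular_value_decomposition (T : E →ₗ[ℝ] F) :
    ∃ (u : Fin (finrank ℝ T.range) → F) (v : Fin (finrank ℝ T.range) → E),
      Orthonormal ℝ u ∧ Orthonormal ℝ v ∧
      ∀ x, T x = ∑ i : Fin (finrank ℝ T.range), (T.singularValues i * ⟪v i, x⟫_ℝ) • u i := by
  set e := T.isSymmetric_adjoint_comp_self.eigenvectorBasis rfl with he
  have hrank : finrank ℝ T.range ≤ finrank ℝ E := LinearMap.finrank_range_le T
  have hin : ∀ i j, ⟪T (e i), T (e j)⟫_ℝ = if i = j then T.singularValues i ^ 2 else 0 := by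
    intro i j
    rw [← LinearMap.adjoint_inner_left, ← LinearMap.comp_apply, he,
      T.isSymmetric_adjoint_comp_self.apply_eigenvectorBasis rfl, ← he, inner_smul_left,
      ← T.sq_singularValues_fin rfl, orthonormal_iff_ite.1 e.orthonormal i j]
    simp
  set c := Fin.castLE hrank with hc
  have hpos : ∀ i : Fin (finrank ℝ T.range), 0 < T.singularValues (c i) := fun i =>
    T.singularValues_pos_iff_lt_finrank_range.2 i.2
  refine ⟨fun i => (T.singularValues (c i))⁻¹ • T (e (c i)), e ∘ c, ?_,
    e.orthonormal.comp _ (Fin.castLE_injective hrank), fun x => ?_⟩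
  · refine orthonormal_iff_ite.2 fun i j => ?_
    simp only [inner_smul_left, inner_smul_right, hin, hc, (Fin.castLE_injective hrank).eq_iff]
    split_ifs with h
    · subst h
      have := (hpos i).ne'
      simp only [conj_trivial]
      field_simp
      exact div_self this
    · simp
  · have hx : T x = ∑ j, ⟪e j, x⟫_ℝ • T (e j) := by
      conv_lhs => rw [← e.sum_repr' x]
      simp
    have hzero : ∀ j : Fin (finrank ℝ E), j ∉ Finset.univ.image c → T (e j) = 0 := by
      intro j hj
      have hj' : finrank ℝ T.range ≤ j := by
        by_contra! h
        exact hj (Finset.mem_image.2 ⟨⟨j, h⟩, Finset.mem_univ _, Fin.ext rfl⟩)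
      rw [← inner_self_eq_zero (𝕜 := ℝ), hin, if_pos rfl,
        T.singularValues_eq_zero_iff_le_finrank_range.2 hj']
      simp
    rw [hx, ← Finset.sum_subset (Finset.subset_univ (Finset.univ.image c)) fun j _ hj => by
      rw [hzero j hj, smul_zero],
      Finset.sum_image fun _ _ _ _ h => Fin.castLE_injective hrank h]
    refine Finset.sum_congr rfl fun i _ => ?_
    rw [smul_smul]
    congr 1
    have h0 := (hpos i).ne'
    have h1 : T.singularValues (c i) = T.singularValues i := rfl
    rw [← h1, Function.comp_apply]
    field_simp
    rfl

/-- Spectral decomposition of the symmetric dilation `(y, x) ↦ (T x, T† y)`. -/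
theorem LinearMap.exists_dilation_decomposition (T : E →ₗ[ℝ] F) :
    ∃ p n : Fin (finrank ℝ T.range) → WithLp 2 (F × E),
      Orthonormal ℝ p ∧ Orthonormal ℝ n ∧ (∀ i j, ⟪p i, n j⟫_ℝ = 0) ∧
      ∀ x, ∑ i : Fin (finrank ℝ T.range),
        T.singularValues i * (⟪p i, x⟫_ℝ ^ 2 - ⟪n i, x⟫_ℝ ^ 2) =
          2 * ⟪x.ofLp.1, T x.ofLp.2⟫_ℝ := by
  obtain ⟨u, v, hu, hv, hT⟩ := T.exists_singular_value_decomposition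
  have h2 : (√2)⁻¹ * (√2)⁻¹ = (1 / 2 : ℝ) := by
    rw [← mul_inv, Real.mul_self_sqrt (by norm_num)]; norm_num
  rw [orthonormal_iff_ite] at hu hv
  refine ⟨fun i => (√2)⁻¹ • WithLp.toLp 2 (u i, v i),
    fun i => (√2)⁻¹ • WithLp.toLp 2 (u i, -v i), ?_, ?_, ?_, ?_⟩
  · refine orthonormal_iff_ite.2 fun i j => ?_
    rw [inner_smul_left, inner_smul_right, ← mul_assoc, conj_trivial, h2,
      WithLp.prod_inner_apply]
    simp only [hu, hv]
    split_ifs <;> norm_num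
  · refine orthonormal_iff_ite.2 fun i j => ?_
    rw [inner_smul_left, inner_smul_right, ← mul_assoc, conj_trivial, h2,
      WithLp.prod_inner_apply]
    simp only [inner_neg_neg, hu, hv]
    split_ifs <;> norm_num
  · intro i j
    rw [inner_smul_left, inner_smul_right, WithLp.prod_inner_apply]
    simp only [inner_neg_right, hu, hv]
    simp
  · intro x
    rw [hT, inner_sum, Finset.mul_sum]
    refine Finset.sum_congr rfl fun i _ => ?_
    rw [inner_smul_left, inner_smul_left, inner_smul_right, WithLp.prod_inner_apply,
      WithLp.prod_inner_apply, mul_pow, mul_pow, conj_trivial, pow_two (√2)⁻¹, h2,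
      real_inner_comm (u i) x.ofLp.1]
    simp only [inner_neg_left]
    ring

/-- A perturbation bound for the sum of the singular values: it decreases from `A` to `A + Z` by at
most the sum of the leading `rank A` singular values of `Z` minus the sum of the remaining ones. -/
theorem LinearMap.sum_singularValues_add_le (A Z : E →ₗ[ℝ] F) {N : ℕ}
    (hN : finrank ℝ E ≤ N) :
    (A.singularValues.sum fun _ s => s) +
        ∑ i ∈ Finset.Ico (finrank ℝ A.range) N, Z.singularValues i ≤
      ((A + Z).singularValues.sum fun _ s => s) +
        ∑ i ∈ Finset.range (finrank ℝ A.range), Z.singularValues i := by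
  obtain ⟨pa, na, hpa, hna, hpna, hqa⟩ := A.exists_dilation_decomposition
  obtain ⟨pb, nb, hpb, hnb, hpnb, hqb⟩ := Z.exists_dilation_decomposition
  obtain ⟨pc, nc, hpc, hnc, hpnc, hqc⟩ := (A + Z).exists_dilation_decomposition
  have hd : finrank ℝ (WithLp 2 (F × E)) = finrank ℝ F + finrank ℝ E := by
    rw [(WithLp.linearEquiv 2 ℝ (F × E)).finrank_eq, finrank_prod]
  have hA1 : finrank ℝ A.range ≤ finrank ℝ E := LinearMap.finrank_range_le A
  have hA2 : finrank ℝ A.range ≤ finrank ℝ F := Submodule.finrank_le _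
  have hZ1 : finrank ℝ Z.range ≤ finrank ℝ E := LinearMap.finrank_range_le Z
  have key := sum_add_sum_le_of_quadratic_eq_add (H := WithLp 2 (F × E))
    A.singularValues_antitone A.singularValues_nonneg A.singularValues_finrank_range_self
    Z.singularValues_antitone Z.singularValues_nonneg
    (fun i hi => Z.singularValues_eq_zero_iff_le_finrank_range.2 hi)
    (A + Z).singularValues_nonneg hpa hna hpna hpb hnb hpnb hpc
    (fun x => by
      rw [hqa, hqb, hqc, LinearMap.add_apply, inner_add_right, mul_add]) (by omega) (by omega)
  rw [A.sum_singularValues_eq le_rfl, (A + Z).sum_singularValues_eq le_rfl]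
  refine le_trans (le_of_eq ?_) key
  congr 1
  refine (Finset.sum_subset (Finset.Ico_subset_Ico_right (by omega)) fun i hi hi' => ?_).symm
  simp only [Finset.mem_Ico, not_and, not_lt] at hi hi'
  exact Z.singularValues_eq_zero_iff_le_finrank_range.2 ((le_max_right _ _).trans (hi' hi.1))

end SingularValueDecomposition

/-! ### Sparse recovery in an orthonormal system. -/

/-- The minimum of a linear form over the polytope `{w | 0 ≤ w ≤ α, ∑ w ≤ r α}` is attained at a
vertex `α 1_S` with `|S| ≤ r`. -/
theorem exists_card_le_mul_sum_le {ι : Type*} (A : Finset ι) (r : ℕ) {α : ℝ} (c w : ι → ℝ)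
    (hw0 : ∀ i ∈ A, 0 ≤ w i) (hw : ∀ i ∈ A, w i ≤ α) (hsum : ∑ i ∈ A, w i ≤ r * α) :
    ∃ S ⊆ A, S.card ≤ r ∧ α * ∑ i ∈ S, c i ≤ ∑ i ∈ A, c i * w i := by
  classical
  obtain ⟨S, hS, hmin⟩ := (A.powerset.filter fun S => S.card ≤ r).exists_min_image
    (fun S => ∑ i ∈ S, c i) ⟨∅, by simp⟩
  simp only [Finset.mem_filter, Finset.mem_powerset] at hS hmin
  obtain ⟨hSA, hSr⟩ := hS
  refine ⟨S, hSA, hSr, ?_⟩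
  have hneg : ∀ j ∈ S, c j ≤ 0 := by
    intro j hj
    have := hmin (S.erase j) ⟨(Finset.erase_subset _ _).trans hSA,
      (Finset.card_le_card (Finset.erase_subset _ _)).trans hSr⟩
    have h2 := Finset.add_sum_erase S c hj
    linarith
  have hexch : ∀ j ∈ S, ∀ i ∈ A \ S, c j ≤ c i := by
    intro j hj i hi
    rw [Finset.mem_sdiff] at hi
    have hi' : i ∉ S.erase j := fun h => hi.2 (Finset.mem_of_mem_erase h)
    have := hmin (insert i (S.erase j)) ⟨Finset.insert_subset hi.1
      ((Finset.erase_subset _ _).trans hSA), by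
        rw [Finset.card_insert_of_notMem hi', Finset.card_erase_add_one hj]; exact hSr⟩
    rw [Finset.sum_insert hi'] at this
    have h2 := Finset.add_sum_erase S c hj
    linarith
  have hpos : S.card < r → ∀ i ∈ A \ S, 0 ≤ c i := by
    intro hlt i hi
    rw [Finset.mem_sdiff] at hi
    have := hmin (insert i S) ⟨Finset.insert_subset hi.1 hSA, by
      rw [Finset.card_insert_of_notMem hi.2]; omega⟩
    rw [Finset.sum_insert hi.2] at this
    linarith
  -- `θ` is a dual multiplier: a threshold separating `c` on `S` from `c` off `S`, with
  -- complementary slackness as an inequality.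
  obtain ⟨θ, hθ1, hθ2, hθ3⟩ : ∃ θ : ℝ, (∀ j ∈ S, c j ≤ θ) ∧ (∀ i ∈ A \ S, θ ≤ c i) ∧
      0 ≤ θ * (∑ i ∈ A, w i - S.card * α) := by
    rcases hSr.lt_or_eq with hlt | heq
    · exact ⟨0, hneg, hpos hlt, by simp⟩
    rcases S.eq_empty_or_nonempty with rfl | hne
    · have hr : r = 0 := by simpa using heq.symm
      subst hr
      have h0 : ∑ i ∈ A, w i = 0 := le_antisymm (by simpa using hsum) (Finset.sum_nonneg hw0)
      refine ⟨if h : A.Nonempty then A.inf' h c else 0, by simp, fun i hi => ?_, by simp [h0]⟩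
      rw [Finset.sdiff_empty] at hi
      rw [dif_pos ⟨i, hi⟩]
      exact Finset.inf'_le _ hi
    · refine ⟨S.sup' hne c, fun j hj => Finset.le_sup' _ hj, fun i hi =>
        Finset.sup'_le _ _ fun j hj => hexch j hj i hi, ?_⟩
      refine mul_nonneg_of_nonpos_of_nonpos (Finset.sup'_le _ _ hneg) ?_
      rw [heq]; linarith
  have h1 : ∑ i ∈ A, c i * w i = ∑ i ∈ A \ S, c i * w i + ∑ i ∈ S, c i * w i :=
    (Finset.sum_sdiff hSA).symm
  have h2 : ∑ i ∈ A, w i = ∑ i ∈ A \ S, w i + ∑ i ∈ S, w i := (Finset.sum_sdiff hSA).symm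
  have h3 : ∑ i ∈ A \ S, θ * w i ≤ ∑ i ∈ A \ S, c i * w i :=
    Finset.sum_le_sum fun i hi => mul_le_mul_of_nonneg_right (hθ2 i hi)
      (hw0 i (Finset.sdiff_subset hi))
  have h4 : ∑ j ∈ S, c j * (α - w j) ≤ ∑ j ∈ S, θ * (α - w j) :=
    Finset.sum_le_sum fun j hj => mul_le_mul_of_nonneg_right (hθ1 j hj)
      (sub_nonneg.2 (hw j (hSA hj)))
  simp only [mul_sub, Finset.sum_sub_distrib, ← Finset.mul_sum, ← Finset.sum_mul] at h3 h4
  rw [Finset.sum_const, nsmul_eq_mul] at h4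
  rw [h2] at hθ3
  nlinarith

section SparseRecovery

variable {V W : Type*} [NormedAddCommGroup V] [InnerProductSpace ℝ V]
  [NormedAddCommGroup W] [InnerProductSpace ℝ W]

/-- The parallelogram-type estimate behind sparse recovery: if `G` distorts the squared norms of the
combinations of `t` and `w` by a factor between `1 - δ` and `1 + δ`, with `δ ≤ 1 / 2`,
then `⟪G t, G (t + w)⟫` controls `‖t‖ ^ 2`. -/
theorem norm_sq_le_of_restricted_isometry (G : V →ₗ[ℝ] W) {δ : ℝ} (hδ : δ ≤ 1 / 2)
    (hδ0 : 0 ≤ δ) {t w : V} (htw : ⟪t, w⟫_ℝ = 0) (hwt : ‖w‖ ^ 2 ≤ ‖t‖ ^ 2)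
    (h : ∀ a b : ℝ, (1 - δ) * ‖a • t + b • w‖ ^ 2 ≤ ‖G (a • t + b • w)‖ ^ 2 ∧
      ‖G (a • t + b • w)‖ ^ 2 ≤ (1 + δ) * ‖a • t + b • w‖ ^ 2) :
    ‖t‖ ^ 2 ≤ 4 * ⟪G t, G (t + w)⟫_ℝ := by
  have hn : ∀ a b : ℝ, ‖a • t + b • w‖ ^ 2 = a ^ 2 * ‖t‖ ^ 2 + b ^ 2 * ‖w‖ ^ 2 := by
    intro a b
    rw [norm_add_sq_real, inner_smul_left, inner_smul_right, htw, norm_smul, norm_smul, mul_pow,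
      mul_pow, Real.norm_eq_abs, Real.norm_eq_abs, sq_abs, sq_abs]
    simp
  have hG : ∀ a b : ℝ, ‖G (a • t + b • w)‖ ^ 2 =
      a ^ 2 * ‖G t‖ ^ 2 + 2 * (a * b) * ⟪G t, G w⟫_ℝ + b ^ 2 * ‖G w‖ ^ 2 := by
    intro a b
    rw [map_add, map_smul, map_smul, norm_add_sq_real, inner_smul_left, inner_smul_right,
      norm_smul, norm_smul, mul_pow, mul_pow, Real.norm_eq_abs, Real.norm_eq_abs, sq_abs, sq_abs]
    simp only [conj_trivial]
    ring
  -- The weights cancel `‖G w‖ ^ 2`: the first form minus four times the second is `24 / 25 * ⟪G t,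
  -- G (t + w)⟫`. With `δ ≤ 1 / 2` it is at least `7 / 25 * ‖t‖ ^ 2`, and `24 / 7 ≤ 4`.
  have h1 := (h 1 (2 / 5)).1
  have h2 := (h (1 / 10) (-1 / 5)).2
  rw [hn, hG] at h1 h2
  rw [map_add, inner_add_right, real_inner_self_eq_norm_sq]
  nlinarith [sq_nonneg ‖t‖, mul_le_mul_of_nonneg_left hwt hδ0,
    mul_le_mul_of_nonneg_right hδ (sq_nonneg ‖t‖)]

/-- A nonincreasing coefficient sequence in the kernel of a restricted isometry is zero as soon as
its leading `r` entries dominate the others in sum. -/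
theorem sum_smul_eq_zero_of_restricted_isometry {k r : ℕ} (G : V →ₗ[ℝ] W) {B : Fin k → V}
    (hB : Orthonormal ℝ B) {s : ℕ → ℝ} (hs : Antitone s) (hs0 : ∀ i, 0 ≤ s i)
    {δ : ℝ} (hδ : δ ≤ 1 / 2) (hδ0 : 0 ≤ δ)
    (h : ∀ (S : Finset (Fin k)) (c : Fin k → ℝ), S.card ≤ 2 * r →
      (1 - δ) * ‖∑ i ∈ S, c i • B i‖ ^ 2 ≤ ‖G (∑ i ∈ S, c i • B i)‖ ^ 2 ∧
      ‖G (∑ i ∈ S, c i • B i)‖ ^ 2 ≤ (1 + δ) * ‖∑ i ∈ S, c i • B i‖ ^ 2)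
    (hle : ∑ i ∈ Finset.univ.filter fun i : Fin k => r ≤ (i : ℕ), s i ≤
      ∑ i ∈ Finset.univ.filter fun i : Fin k => (i : ℕ) < r, s i)
    (hG : G (∑ i : Fin k, s i • B i) = 0) : ∑ i : Fin k, s i • B i = 0 := by
  classical
  set T : Finset (Fin k) := Finset.univ.filter fun i => (i : ℕ) < r with hT
  set A : Finset (Fin k) := Finset.univ.filter fun i => r ≤ (i : ℕ) with hA
  have hTA : Disjoint T A := by
    rw [Finset.disjoint_left]
    intro i hi hi'
    simp only [hT, hA, Finset.mem_filter] at hi hi'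
    omega
  have hTAu : T ∪ A = Finset.univ := by
    ext i
    simp only [hT, hA, Finset.mem_union, Finset.mem_filter, Finset.mem_univ, true_and, iff_true]
    omega
  have hTcard : T.card ≤ r := by
    calc T.card ≤ (Finset.range r).card := Finset.card_le_card_of_injOn Fin.val
          (fun i hi => by simpa [hT] using hi) (fun _ _ _ _ h => Fin.ext h)
      _ = r := Finset.card_range r
  have hsplit : ∑ i : Fin k, s i • B i = ∑ i ∈ T, s i • B i + ∑ i ∈ A, s i • B i := by
    rw [← hTAu, Finset.sum_union hTA]
  have hnormsq : ∀ (S : Finset (Fin k)) (c : Fin k → ℝ),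
      ‖∑ i ∈ S, c i • B i‖ ^ 2 = ∑ i ∈ S, c i ^ 2 := by
    intro S c
    rw [← real_inner_self_eq_norm_sq, hB.inner_sum]
    simp [pow_two]
  set t := ∑ i ∈ T, s i • B i with ht
  suffices hzero : t = 0 by
    have h1 : ∑ i ∈ T, s i ^ 2 = 0 := by rw [← hnormsq T fun i => s i, ← ht, hzero]; simp
    have h2 : ∀ i ∈ T, s i = 0 := fun i hi => by
      simpa using (Finset.sum_eq_zero_iff_of_nonneg fun i _ => sq_nonneg _).1 h1 i hi
    have h3 : ∑ i ∈ A, s i = 0 := le_antisymm (hle.trans (Finset.sum_eq_zero h2).le)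
      (Finset.sum_nonneg fun i _ => hs0 i)
    have h4 := (Finset.sum_eq_zero_iff_of_nonneg fun (i : Fin k) _ => hs0 i).1 h3
    rw [hsplit, hzero, zero_add]
    exact Finset.sum_eq_zero fun i hi => by rw [h4 i hi, zero_smul]
  -- The mean of the leading entries; for `r = 0` division by zero gives `α = 0`, which is the value
  -- needed.
  set α : ℝ := (∑ i ∈ T, s i) / r with hα
  have hαr : r * α = ∑ i ∈ T, s i := by
    rcases Nat.eq_zero_or_pos r with rfl | hr
    · simp [hT]
    · rw [hα]; field_simp
  have hαA : ∀ i ∈ A, s i ≤ α := by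
    intro i hi
    have hir : r ≤ (i : ℕ) := by simpa [hA] using hi
    rcases Nat.eq_zero_or_pos r with rfl | hr
    · have h0 : ∑ i ∈ A, s i = 0 := le_antisymm (hle.trans (by rw [← hαr]; simp))
        (Finset.sum_nonneg fun i _ => hs0 i)
      have := (Finset.sum_eq_zero_iff_of_nonneg fun (i : Fin k) _ => hs0 i).1 h0 i hi
      simp [this, hα]
    -- A tail index exists, so the head is full and `α` averages `r` entries, each at least `s i`.
    · have hTr : T.card = r := by
        have : T = Finset.univ.image (Fin.castLE (hir.trans i.2.le)) := by
          ext j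
          simp only [hT, Finset.mem_filter, Finset.mem_univ, true_and, Finset.mem_image]
          exact ⟨fun h => ⟨⟨j, h⟩, Fin.ext rfl⟩, fun ⟨l, hl⟩ => hl ▸ l.2⟩
        rw [this, Finset.card_image_of_injective _ (Fin.castLE_injective _), Finset.card_fin]
      rw [hα, le_div_iff₀ (by exact_mod_cast hr)]
      have : ∑ _j ∈ T, s i ≤ ∑ j ∈ T, s j := Finset.sum_le_sum fun j hj => hs (by
        simp only [hT, Finset.mem_filter] at hj; omega)
      rw [Finset.sum_const, hTr, nsmul_eq_mul] at this
      linarith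
  obtain ⟨S, hSA, hSr, hS⟩ := exists_card_le_mul_sum_le A r
    (fun i => ⟪G t, G (B i)⟫_ℝ) (fun i : Fin k => s i) (fun i _ => hs0 i) hαA (hle.trans hαr.ge)
  have hTS : Disjoint T S := hTA.mono_right hSA
  set w := ∑ i ∈ S, α • B i with hw
  have htw : ⟪t, w⟫_ℝ = 0 := by
    rw [ht, hw, sum_inner]
    refine Finset.sum_eq_zero fun i hi => ?_
    rw [inner_sum]
    refine Finset.sum_eq_zero fun j hj => ?_
    rw [inner_smul_left, inner_smul_right, hB.2 (Finset.disjoint_iff_ne.1 hTS i hi j hj)]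
    simp
  have hwt : ‖w‖ ^ 2 ≤ ‖t‖ ^ 2 := by
    rw [hw, ht, hnormsq S fun _ => α, hnormsq T fun i => s i, Finset.sum_const, nsmul_eq_mul]
    have h1 : (S.card : ℝ) * α ^ 2 ≤ r * α ^ 2 :=
      mul_le_mul_of_nonneg_right (by exact_mod_cast hSr) (sq_nonneg _)
    refine h1.trans ?_
    rcases Nat.eq_zero_or_pos r with hr | hr
    · simpa [hr] using Finset.sum_nonneg fun (i : Fin k) (_ : i ∈ T) => sq_nonneg (s i)
    · have h2 : (∑ i ∈ T, s i) ^ 2 ≤ T.card * ∑ i ∈ T, s i ^ 2 := sq_sum_le_card_mul_sum_sq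
      have h3 : (T.card : ℝ) * ∑ i ∈ T, s i ^ 2 ≤ r * ∑ i ∈ T, s i ^ 2 :=
        mul_le_mul_of_nonneg_right (by exact_mod_cast hTcard)
          (Finset.sum_nonneg fun _ _ => sq_nonneg _)
      have hr' : (0 : ℝ) < r := by exact_mod_cast hr
      rw [← hαr] at h2
      refine le_of_mul_le_mul_left ?_ hr'
      linarith [mul_pow (r : ℝ) α 2]
  have hineq := norm_sq_le_of_restricted_isometry G hδ hδ0 htw hwt fun a b => by
    have hsum : a • t + b • w =
        ∑ i ∈ T ∪ S, (if i ∈ T then a * s i else b * α) • B i := by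
      rw [Finset.sum_union hTS, ht, hw, Finset.smul_sum, Finset.smul_sum]
      congr 1
      · exact Finset.sum_congr rfl fun i hi => by rw [if_pos hi, smul_smul]
      · exact Finset.sum_congr rfl fun i hi => by
          rw [if_neg (Finset.disjoint_right.1 hTS hi), smul_smul]
    rw [hsum]
    exact h _ _ ((Finset.card_union_le _ _).trans (by omega))
  have hSle : ⟪G t, G w⟫_ℝ ≤ ⟪G t, G (∑ i ∈ A, s i • B i)⟫_ℝ := by
    simp only [hw, map_sum, map_smul, inner_sum, inner_smul_right]
    rw [Finset.mul_sum] at hS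
    simpa only [mul_comm (s _)] using hS
  have hle0 : ⟪G t, G (t + w)⟫_ℝ ≤ 0 := by
    rw [map_add, inner_add_right]
    calc _ ≤ ⟪G t, G t⟫_ℝ + ⟪G t, G (∑ i ∈ A, s i • B i)⟫_ℝ := by linarith
      _ = 0 := by rw [← inner_add_right, ← map_add, ← hsplit, hG, inner_zero_right]
  have : ‖t‖ ^ 2 = 0 := le_antisymm (by linarith) (sq_nonneg _)
  simpa using this

end SparseRecovery

/-! ### Unfoldings and rank-one tensors. -/

namespace Tensor

variable {N : ℕ} {I : Fin N → ℕ}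

/-- The mode-`n` unfolding as a linear map between Euclidean spaces. -/
noncomputable def unfoldLin (n : Fin N) : Tensor I →ₗ[ℝ]
    (EuclideanSpace ℝ ((k : {k : Fin N // k ≠ n}) → Fin (I k)) →ₗ[ℝ]
      EuclideanSpace ℝ (Fin (I n))) where
  toFun X := Matrix.toEuclideanLin (unfold n X)
  map_add' X Y := by rw [← map_add]; rfl
  map_smul' c X := by rw [RingHom.id_apply, ← map_smul]; rfl

theorem unfoldLin_injective (n : Fin N) : Function.Injective (unfoldLin (I := I) n) := by
  intro X Y h
  have h' : unfold n X = unfold n Y := Matrix.toEuclideanLin.injective h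
  ext i
  have := congrFun (congrFun h' (Equiv.piSplitAt n (fun k => Fin (I k)) i).1)
    (Equiv.piSplitAt n (fun k => Fin (I k)) i).2
  simpa only [unfold, Matrix.of_apply, Prod.mk.eta, Equiv.symm_apply_apply] using this

theorem finrank_range_unfoldLin (n : Fin N) (X : Tensor I) :
    finrank ℝ (unfoldLin n X).range = (unfold n X).rank :=
  (Matrix.rank_eq_finrank_range_toLin _ (PiLp.basisFun 2 ℝ _) (PiLp.basisFun 2 ℝ _)).symm

/-- The tensor whose mode-`n` unfolding is the rank-one matrix `f eᵀ`. -/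
noncomputable def outer (n : Fin N) (f : EuclideanSpace ℝ (Fin (I n)))
    (e : EuclideanSpace ℝ ((k : {k : Fin N // k ≠ n}) → Fin (I k))) : Tensor I :=
  WithLp.toLp 2 fun i => f (i n) * e fun k => i k

theorem inner_outer (n : Fin N) (f f' : EuclideanSpace ℝ (Fin (I n)))
    (e e' : EuclideanSpace ℝ ((k : {k : Fin N // k ≠ n}) → Fin (I k))) :
    ⟪outer n f e, outer n f' e'⟫_ℝ = ⟪f, f'⟫_ℝ * ⟪e, e'⟫_ℝ := by
  simp only [PiLp.inner_apply, outer, Finset.sum_mul_sum]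
  rw [← Fintype.sum_prod_type', ← (Equiv.piSplitAt n fun k => Fin (I k)).sum_comp]
  refine Finset.sum_congr rfl fun i _ => ?_
  simp [Equiv.piSplitAt]
  ring

theorem unfoldLin_outer (n : Fin N) (f : EuclideanSpace ℝ (Fin (I n)))
    (e x : EuclideanSpace ℝ ((k : {k : Fin N // k ≠ n}) → Fin (I k))) :
    unfoldLin n (outer n f e) x = ⟪e, x⟫_ℝ • f := by
  have h : unfold n (outer n f e) = Matrix.vecMulVec f e := by
    ext i j
    have hs := (Equiv.piSplitAt n fun k => Fin (I k)).apply_symm_apply (i, j)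
    exact congrArg₂ (f · * e ·) (congrArg Prod.fst hs) (congrArg Prod.snd hs)
  change Matrix.toEuclideanLin (unfold n (outer n f e)) x = _
  ext i
  rw [h, Matrix.toLpLin_apply]
  simp [Matrix.vecMulVec_mulVec, PiLp.inner_apply, dotProduct, mul_comm]

theorem orthonormal_outer (n : Fin N) {ι : Type*} {u : ι → EuclideanSpace ℝ (Fin (I n))}
    {v : ι → EuclideanSpace ℝ ((k : {k : Fin N // k ≠ n}) → Fin (I k))}
    (hu : Orthonormal ℝ u) (hv : Orthonormal ℝ v) :
    Orthonormal ℝ fun i => outer n (u i) (v i) := by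
  classical
  rw [orthonormal_iff_ite] at hu hv ⊢
  intro i j
  rw [inner_outer, hu, hv]
  split_ifs <;> simp

/-- The range of the unfolding lies in the span of the `u i`. This turns sparsity in a singular
system into low mode-`n` rank. -/
theorem rank_unfold_sum_outer_le (n : Fin N) {ι : Type*} (S : Finset ι) (c : ι → ℝ)
    (u : ι → EuclideanSpace ℝ (Fin (I n)))
    (v : ι → EuclideanSpace ℝ ((k : {k : Fin N // k ≠ n}) → Fin (I k))) :
    (unfold n (∑ i ∈ S, c i • outer n (u i) (v i))).rank ≤ S.card := by
  classical
  rw [← finrank_range_unfoldLin]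
  have hle : (unfoldLin n (∑ i ∈ S, c i • outer n (u i) (v i))).range ≤
      Submodule.span ℝ ((S.image u : Finset _) : Set (EuclideanSpace ℝ (Fin (I n)))) := by
    rintro _ ⟨x, rfl⟩
    simp only [map_sum, map_smul, LinearMap.sum_apply, LinearMap.smul_apply, unfoldLin_outer]
    exact Submodule.sum_mem _ fun i hi => Submodule.smul_mem _ _ (Submodule.smul_mem _ _
      (Submodule.subset_span (Finset.mem_coe.2 (Finset.mem_image_of_mem _ hi))))
  exact (Submodule.finrank_mono hle).trans
    ((finrank_span_finset_le_card _).trans Finset.card_image_le)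

/-- Under the restricted isometry property in mode `n`, moving a tensor of low mode-`n` rank within
a fibre of `F` strictly increases the trace norm of its mode-`n` unfolding. -/
theorem matrixTraceNorm_unfold_lt {m : ℕ} (F : Tensor I →ₗ[ℝ] EuclideanSpace ℝ (Fin m))
    (n : Fin N) {r : ℕ} (hF : ripConst F (Function.update I n (2 * r)) ≤ 1 / 2)
    {X Y : Tensor I} (hX : (unfold n X).rank ≤ r) (hXY : F Y = F X) (hne : Y ≠ X) :
    matrixTraceNorm (unfold n X) < matrixTraceNorm (unfold n Y) := by
  by_contra! hcon
  apply hne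
  obtain ⟨Z, rfl⟩ : ∃ Z, Y = X + Z := ⟨Y - X, by abel⟩
  have hFZ : F Z = 0 := by simpa using hXY
  set A := unfoldLin n X with hA
  set D := unfoldLin n Z with hD
  obtain ⟨u, v, hu, hv, hsvd⟩ := D.exists_singular_value_decomposition
  have hZ : ∑ i : Fin (finrank ℝ D.range), D.singularValues i • outer n (u i) (v i) = Z := by
    apply unfoldLin_injective n
    ext1 x
    rw [← hD, hsvd]
    simp only [map_sum, map_smul, LinearMap.sum_apply, LinearMap.smul_apply, unfoldLin_outer,
      smul_smul]
  have hXr : finrank ℝ A.range ≤ r := by rw [hA, finrank_range_unfoldLin]; exact hX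
  obtain ⟨hδ0, hrip⟩ := (isLeast_ripConst F (Function.update I n (2 * r))).1
  have hpert := A.sum_singularValues_add_le D (le_refl _)
  have htail : ∑ i ∈ Finset.Ico (finrank ℝ A.range) (finrank ℝ
      (EuclideanSpace ℝ ((k : {k : Fin N // k ≠ n}) → Fin (I k)))), D.singularValues i ≤
      ∑ i ∈ Finset.range (finrank ℝ A.range), D.singularValues i := by
    have h1 : ((A + D).singularValues.sum fun _ s => s) ≤ A.singularValues.sum fun _ s => s := by
      rw [hA, hD, ← map_add]; exact hcon
    linarith
  have hzero : ∀ i, finrank ℝ D.range ≤ i → D.singularValues i = 0 := fun i hi =>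
    D.singularValues_eq_zero_iff_le_finrank_range.2 hi
  have hfin : ∀ P : ℕ → Prop, ∀ [DecidablePred P],
      ∑ i ∈ Finset.univ.filter fun i : Fin (finrank ℝ D.range) => P i, D.singularValues i =
        ∑ i ∈ Finset.range (finrank ℝ D.range) with P i, D.singularValues i := by
    intro P _
    rw [Finset.sum_filter, Finset.sum_filter,
      ← Fin.sum_univ_eq_sum_range fun i => if P i then D.singularValues i else 0]
  -- The split is at the exact rank of `A`, as in the perturbation bound. In the modes other than
  -- `n` the rank bound `I k` is automatic.
  have hZ0 := sum_smul_eq_zero_of_restricted_isometry (r := finrank ℝ A.range) F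
    (orthonormal_outer n hu hv) D.singularValues_antitone D.singularValues_nonneg hF hδ0
    (fun S c hS => hrip _ fun k => by
      rcases eq_or_ne k n with rfl | hk
      · rw [Function.update_self]
        exact (rank_unfold_sum_outer_le k S c u v).trans (by omega)
      · rw [Function.update_of_ne hk]
        exact (Matrix.rank_le_card_height _).trans (Fintype.card_fin _).le)
    (by
      rw [hfin fun i => finrank ℝ A.range ≤ i, hfin fun i => i < finrank ℝ A.range]
      refine le_trans (Finset.sum_le_sum_of_subset_of_nonneg (fun i hi => ?_)
        fun _ _ _ => D.singularValues_nonneg _) (htail.trans (le_of_eq ?_))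
      · have := LinearMap.finrank_range_le D
        simp only [Finset.mem_filter, Finset.mem_range, Finset.mem_Ico] at hi ⊢
        omega
      · refine (Finset.sum_subset (fun i hi => ?_) fun i hi hi' => hzero i ?_).symm
        · simp only [Finset.mem_filter, Finset.mem_range] at hi ⊢
          omega
        · simp only [Finset.mem_filter, Finset.mem_range] at hi hi'
          omega)
    (by rw [hZ, hFZ])
  rw [hZ] at hZ0
  rw [hZ0, add_zero]

end Tensor

theorem theorem8 {N m : ℕ} (hN : 1 ≤ N) (I : Fin N → ℕ) (r : Fin N → ℕ)
    (F : Tensor I →ₗ[ℝ] EuclideanSpace ℝ (Fin m))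
    (hF : ∀ n : Fin N,
      Tensor.ripConst F (Function.update I n (2 * r n)) < (77 - Real.sqrt 1337) / 82) :
    ∀ X₀ ∈ Tensor.lowRank I r, Tensor.traceNormSolutions F (F X₀) = {X₀} := by
  intro X₀ hX₀
  -- `36 ^ 2 = 1296 ≤ 1337`, and `(77 - 36) / 82 = 1 / 2`.
  have hbound : (77 - Real.sqrt 1337) / 82 ≤ 1 / 2 := by
    have : (36 : ℝ) ≤ Real.sqrt 1337 := Real.le_sqrt_of_sq_le (by norm_num)
    linarith
  have hlt : ∀ Y, F Y = F X₀ → Y ≠ X₀ → Tensor.traceNorm X₀ < Tensor.traceNorm Y := by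
    intro Y hY hne
    have hN' : (0 : ℝ) < N := by exact_mod_cast hN
    refine mul_lt_mul_of_pos_left ?_ (by positivity)
    exact Finset.sum_lt_sum_of_nonempty ⟨⟨0, hN⟩, Finset.mem_univ _⟩ fun n _ =>
      Tensor.matrixTraceNorm_unfold_lt F n ((hF n).le.trans hbound) (hX₀ n) hY hne
  ext Y
  rw [Set.mem_singleton_iff]
  constructor
  · rintro ⟨hY, hmin⟩
    by_contra hne
    exact (hlt Y hY hne).not_ge (hmin X₀ rfl)
  · rintro rfl
    refine ⟨rfl, fun X hX => ?_⟩
    rcases eq_or_ne X Y with rfl | hne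
    · exact le_rfl
    · exact (hlt X hX hne).le
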